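/- Let $k$ be a field and let $Q\subset\mathbb Z^N$ be a finitely generated submonoid which is homogeneous, i.e. its minimal generating set lies on a hyperplane of $\mathbb R^N$ not containing the origin. Let $d=\operatorname{rank}\mathbb ZQ$ be its dimension and let $\overline Q=\mathbb ZQ\cap\mathbb R_{\ge 0}Q$ be its normalization. Grade the monoid algebras $k[Q]\subset k[\overline Q]$ so that the monomials of the minimal generators of $Q$ have degree $1$. Then both algebras have Krull dimension $d$ and finite-dimensional graded pieces, and there are polynomials $h_Q,h_{\overline Q}\in\mathbb Z[t]$ (the $h$-polynomials) with $$\sum_{n\ge 0}\dim_k k[Q]_n\,t^n=\frac{h_Q(t)}{(1-t)^d},\qquad \sum_{n\ge 0}\dim_k k[\overline Q]_n\,t^n=\frac{h_{\overline Q}(t)}{(1-t)^d}.$$ Moreover $h_Q(1)=h_{\overline Q}(1)$, and $1-t$ divides $h_{\overline Q}(t)-h_Q(t)$ in $\mathbb Z[t]$. That is, $k[Q]$ and $k[\overline Q]$ have the same multiplicity, and it equals $h_Q(1)=h_{\overline Q}(1)$; here the multiplicity of a graded algebra $R$ of dimension $d$ is $\lim_{n\to\infty}(d-1)!\,\dim_k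 R_n/n^{d-1}$ if $d\ge1$, and $\dim_k R$ if $d=0$. -/

import Mathlib

open Polynomial Filter Topology

/-! ### Affine monoids, their normalizations, and homogeneity -/

/-- The inclusion of the lattice `ℤ^N` in `ℝ^N`. -/
def latticeToReal (N : ℕ) : (Fin N → ℤ) →+ (Fin N → ℝ) where
  toFun α i := (α i : ℝ)
  map_zero' := by ext i; simp
  map_add' α β := by ext i; simp

/-- The group `ℤQ` generated by `Q`. -/
def groupSpan {N : ℕ} (Q : AddSubmonoid (Fin N → ℤ)) : AddSubgroup (Fin N → ℤ) :=
  AddSubgroup.closure (Q : Set (Fin N → ℤ))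

/-- The cone `ℝ_{≥0} Q` generated by `Q`. -/
noncomputable def coneSpan {N : ℕ} (Q : AddSubmonoid (Fin N → ℤ)) :
    PointedCone ℝ (Fin N → ℝ) :=
  PointedCone.hull ℝ (latticeToReal N '' (Q : Set (Fin N → ℤ)))

/-- The normalization `ℤQ ∩ ℝ_{≥0} Q` of `Q`. -/
noncomputable def normalization {N : ℕ} (Q : AddSubmonoid (Fin N → ℤ)) :
    AddSubmonoid (Fin N → ℤ) where
  carrier := {α | α ∈ groupSpan Q ∧ latticeToReal N α ∈ coneSpan Q}
  zero_mem' := ⟨zero_mem _, by rw [map_zero]; exact zero_mem _⟩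
  add_mem' ha hb := ⟨add_mem ha.1 hb.1, by rw [map_add]; exact add_mem ha.2 hb.2⟩

theorem le_normalization {N : ℕ} (Q : AddSubmonoid (Fin N → ℤ)) : Q ≤ normalization Q :=
  fun α hα => ⟨AddSubgroup.subset_closure hα, PointedCone.subset_hull ⟨α, hα, rfl⟩⟩

/-- `S` is a minimal generating set of the monoid `Q`. -/
def IsMinimalGeneratingSet {N : ℕ} (Q : AddSubmonoid (Fin N → ℤ)) (S : Set (Fin N → ℤ)) : Prop :=
  Minimal (fun T : Set (Fin N → ℤ) => AddSubmonoid.closure T = Q) S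

/-- `Q` is homogeneous: its minimal generating set lies on a hyperplane `φ = c` with `c ≠ 0`,
i.e. on a hyperplane not containing the origin. (Such a `Q` is automatically positive: the
functional `φ / c` is at least `1` on every nonzero element of `Q`, so `0` is the only unit; in
particular its minimal generating set is unique.) -/
def IsHomogeneous {N : ℕ} (Q : AddSubmonoid (Fin N → ℤ)) : Prop :=
  ∃ (S : Set (Fin N → ℤ)) (φ : (Fin N → ℝ) →ₗ[ℝ] ℝ) (c : ℝ),
    IsMinimalGeneratingSet Q S ∧ c ≠ 0 ∧ ∀ α ∈ S, φ (latticeToReal N α) = c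

theorem IsHomogeneous.exists_form {N : ℕ} {Q : AddSubmonoid (Fin N → ℤ)} (h : IsHomogeneous Q) :
    ∃ φ : (Fin N → ℝ) →ₗ[ℝ] ℝ, ∃ S : Set (Fin N → ℤ), IsMinimalGeneratingSet Q S ∧
      ∀ α ∈ S, φ (latticeToReal N α) = 1 := by
  obtain ⟨S, φ, c, hS, hc, h1⟩ := h
  refine ⟨c⁻¹ • φ, S, hS, fun α hα => ?_⟩
  simp [h1 α hα, hc]

/-- A linear form on `ℝ^N` equal to `1` on the minimal generators of `Q`. -/
noncomputable def IsHomogeneous.form {N : ℕ} {Q : AddSubmonoid (Fin N → ℤ)}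
    (h : IsHomogeneous Q) : (Fin N → ℝ) →ₗ[ℝ] ℝ :=
  h.exists_form.choose

theorem IsHomogeneous.form_spec {N : ℕ} {Q : AddSubmonoid (Fin N → ℤ)} (h : IsHomogeneous Q) :
    ∃ S : Set (Fin N → ℤ), IsMinimalGeneratingSet Q S ∧
      ∀ α ∈ S, h.form (latticeToReal N α) = 1 :=
  h.exists_form.choose_spec

theorem IsHomogeneous.form_nat {N : ℕ} {Q : AddSubmonoid (Fin N → ℤ)} (h : IsHomogeneous Q)
    {α : Fin N → ℤ} (hα : α ∈ Q) : ∃ n : ℕ, h.form (latticeToReal N α) = n := by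
  obtain ⟨S, hS, h1⟩ := h.form_spec
  rw [← hS.prop] at hα
  induction hα using AddSubmonoid.closure_induction with
  | mem x hx => exact ⟨1, by simp [h1 x hx]⟩
  | zero => exact ⟨0, by simp⟩
  | add x y _ _ hx hy =>
    obtain ⟨m, hm⟩ := hx
    obtain ⟨n, hn⟩ := hy
    exact ⟨m + n, by simp [hm, hn]⟩

theorem IsHomogeneous.form_nat_normalization {N : ℕ} {Q : AddSubmonoid (Fin N → ℤ)}
    (h : IsHomogeneous Q) {α : Fin N → ℤ} (hα : α ∈ normalization Q) :
    ∃ n : ℕ, h.form (latticeToReal N α) = n := by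
  have hint : ∃ z : ℤ, h.form (latticeToReal N α) = z := by
    have := hα.1
    unfold groupSpan at this
    clear hα
    induction this using AddSubgroup.closure_induction with
    | mem x hx => obtain ⟨n, hn⟩ := h.form_nat hx; exact ⟨n, by simp [hn]⟩
    | zero => exact ⟨0, by simp⟩
    | add x y _ _ hx hy =>
      obtain ⟨m, hm⟩ := hx
      obtain ⟨n, hn⟩ := hy
      exact ⟨m + n, by simp [hm, hn]⟩
    | neg x _ hx => obtain ⟨m, hm⟩ := hx; exact ⟨-m, by simp [hm]⟩
  have hpos : 0 ≤ h.form (latticeToReal N α) := by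
    have := hα.2
    unfold coneSpan at this
    generalize latticeToReal N α = x at this
    induction this using Submodule.span_induction with
    | mem x hx =>
      obtain ⟨β, hβ, rfl⟩ := hx
      obtain ⟨n, hn⟩ := h.form_nat hβ
      simp [hn]
    | zero => simp
    | add x y _ _ hx hy => rw [map_add]; exact add_nonneg hx hy
    | smul r x _ hx =>
      have : h.form (r • x) = (r : ℝ) * h.form x := by
        change h.form ((r : ℝ) • x) = _
        rw [map_smul, smul_eq_mul]
      rw [this]
      exact mul_nonneg r.2 hx
  obtain ⟨z, hz⟩ := hint
  rw [hz] at hpos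
  have hz0 : 0 ≤ z := by exact_mod_cast hpos
  exact ⟨z.toNat, by rw [hz]; exact_mod_cast (Int.toNat_of_nonneg hz0).symm⟩

/-- The degree on the normalization of a homogeneous monoid `Q`: the additive map with value `1`
on the minimal generators of `Q` (see `IsHomogeneous.degree_eq_one`). -/
noncomputable def IsHomogeneous.degree {N : ℕ} {Q : AddSubmonoid (Fin N → ℤ)}
    (h : IsHomogeneous Q) : normalization Q →+ ℕ where
  toFun α := ⌊h.form (latticeToReal N α)⌋₊
  map_zero' := by simp
  map_add' α β := by
    obtain ⟨m, hm⟩ := h.form_nat_normalization α.2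
    obtain ⟨n, hn⟩ := h.form_nat_normalization β.2
    have : h.form (latticeToReal N ((α + β : normalization Q) : Fin N → ℤ)) = ((m + n : ℕ) : ℝ) := by
      simp [hm, hn]
    rw [this, hm, hn]
    simp only [Nat.floor_natCast]

theorem IsHomogeneous.degree_cast {N : ℕ} {Q : AddSubmonoid (Fin N → ℤ)}
    (h : IsHomogeneous Q) (α : normalization Q) :
    (h.degree α : ℝ) = h.form (latticeToReal N α) := by
  obtain ⟨m, hm⟩ := h.form_nat_normalization α.2
  change ((⌊h.form (latticeToReal N α)⌋₊ : ℕ) : ℝ) = _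
  rw [hm, Nat.floor_natCast]

/-- Every element of every minimal generating set of `Q` has degree `1`. -/
theorem IsHomogeneous.degree_eq_one {N : ℕ} {Q : AddSubmonoid (Fin N → ℤ)}
    (h : IsHomogeneous Q) {T : Set (Fin N → ℤ)} (hT : IsMinimalGeneratingSet Q T)
    {α : Fin N → ℤ} (hα : α ∈ T) (hαQ : α ∈ Q) : h.degree ⟨α, le_normalization Q hαQ⟩ = 1 := by
  obtain ⟨S, hS, h1⟩ := h.form_spec
  have key : α ∉ AddSubmonoid.closure (T \ {α}) := by
    intro hmem
    have : T ⊆ T \ {α} := hT.2 (y := T \ {α}) (by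
      change AddSubmonoid.closure (T \ {α}) = Q
      refine le_antisymm ((AddSubmonoid.closure_mono Set.sdiff_subset).trans hT.prop.le) ?_
      rw [← hT.prop, AddSubmonoid.closure_le]
      intro x hx
      by_cases hxα : x = α
      · exact hxα ▸ hmem
      · exact AddSubmonoid.subset_closure ⟨hx, hxα⟩) Set.sdiff_subset
    exact (this hα).2 rfl
  have small : ∀ x ∈ AddSubmonoid.closure T,
      h.form (latticeToReal N x) < h.form (latticeToReal N α) →
        x ∈ AddSubmonoid.closure (T \ {α}) := by
    intro x hx
    induction hx using AddSubmonoid.closure_induction with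
    | mem x hx =>
      intro hlt
      exact AddSubmonoid.subset_closure ⟨hx, fun hxα => by
        rw [Set.mem_singleton_iff] at hxα; rw [hxα] at hlt; exact lt_irrefl _ hlt⟩
    | zero => intro _; exact zero_mem _
    | add x y hx hy ihx ihy =>
      intro hlt
      rw [hT.prop] at hx hy
      obtain ⟨m, hm⟩ := h.form_nat hx
      obtain ⟨n, hn⟩ := h.form_nat hy
      rw [map_add, map_add, hm, hn] at hlt
      have hm0 : (0 : ℝ) ≤ m := m.cast_nonneg
      have hn0 : (0 : ℝ) ≤ n := n.cast_nonneg
      exact add_mem (ihx (by rw [hm]; linarith)) (ihy (by rw [hn]; linarith))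
  have split : ∀ x ∈ AddSubmonoid.closure S, x = 0 ∨ ∃ s ∈ S, ∃ q ∈ Q, x = s + q := by
    intro x hx
    induction hx using AddSubmonoid.closure_induction with
    | mem x hx => exact Or.inr ⟨x, hx, 0, zero_mem _, by simp⟩
    | zero => exact Or.inl rfl
    | add x y hx hy ihx ihy =>
      rw [hS.prop] at hx hy
      rcases ihx with rfl | ⟨s, hs, q, hq, rfl⟩
      · simpa using ihy
      · exact Or.inr ⟨s, hs, q + y, add_mem hq hy, by rw [add_assoc]⟩
  have pos : ∀ x ∈ Q, x ≠ 0 → 1 ≤ h.form (latticeToReal N x) := by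
    intro x hx hx0
    rcases split x (by rw [hS.prop]; exact hx) with h0 | ⟨s, hs, q, hq, rfl⟩
    · exact absurd h0 hx0
    · obtain ⟨n, hn⟩ := h.form_nat hq
      rw [map_add, map_add, h1 s hs, hn]
      simp
  have hα1 : h.form (latticeToReal N α) = 1 := by
    rcases split α (by rw [hS.prop]; exact hαQ) with h0 | ⟨s, hs, q, hq, hsq⟩
    · exact absurd (h0 ▸ zero_mem _) key
    · by_cases hq0 : q = 0
      · rw [hsq, hq0, add_zero, h1 s hs]
      · exfalso
        have hs1 := h1 s hs
        have hsQ : s ∈ Q := by rw [← hS.prop]; exact AddSubmonoid.subset_closure hs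
        have hq1 := pos q hq hq0
        have hadd : h.form (latticeToReal N α) =
            h.form (latticeToReal N s) + h.form (latticeToReal N q) := by
          rw [hsq, map_add, map_add]
        by_cases hs0 : s = 0
        · rw [hs0] at hs1; simp at hs1
        · apply key
          have hqT : q ∈ AddSubmonoid.closure (T \ {α}) :=
            small q (by rw [hT.prop]; exact hq) (by rw [hadd, hs1]; linarith)
          have hsT : s ∈ AddSubmonoid.closure (T \ {α}) :=
            small s (by rw [hT.prop]; exact hsQ) (by rw [hadd, hs1]; linarith)
          rw [hsq] at hqT hsT ⊢
          exact add_mem hsT hqT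
  have := h.degree_cast ⟨α, le_normalization Q hαQ⟩
  rw [hα1] at this
  exact_mod_cast this

/-- The grading of the monoid algebra `k[Q̄]`: the piece of degree `n` is spanned by the monomials
with exponent of degree `n`. -/
noncomputable def normalizationGrading (k : Type*) [Field k] {N : ℕ}
    {Q : AddSubmonoid (Fin N → ℤ)} (h : IsHomogeneous Q) :
    ℕ → Submodule k (AddMonoidAlgebra k (normalization Q)) :=
  AddMonoidAlgebra.gradeBy k h.degree

/-- The grading of the monoid algebra `k[Q]`: the piece of degree `n` is spanned by the monomials
with exponent of degree `n`. -/
noncomputable def monoidGrading (k : Type*) [Field k] {N : ℕ}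
    {Q : AddSubmonoid (Fin N → ℤ)} (h : IsHomogeneous Q) :
    ℕ → Submodule k (AddMonoidAlgebra k Q) :=
  AddMonoidAlgebra.gradeBy k (h.degree.comp (AddSubmonoid.inclusion (le_normalization Q)))

/-! ### Hilbert series, `h`-polynomials and multiplicities of graded algebras -/

/-- The Hilbert series `∑ (dim_k R_n) t^n`. -/
noncomputable def hilbertSeries {k R : Type*} [Field k] [CommRing R] [Algebra k R]
    (𝒜 : ℕ → Submodule k R) : PowerSeries ℤ :=
  PowerSeries.mk fun n => (Module.finrank k (𝒜 n) : ℤ)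

/-- The graded algebra `R` has Krull dimension `d`, finite-dimensional graded pieces, and Hilbert
series `h(t) / (1 - t)^d`: thus `h` is the `h`-polynomial of `R`. -/
def IsHPolynomial {k R : Type*} [Field k] [CommRing R] [Algebra k R]
    (𝒜 : ℕ → Submodule k R) (d : ℕ) (h : ℤ[X]) : Prop :=
  ringKrullDim R = d ∧ (∀ n, Module.Finite k (𝒜 n)) ∧
    hilbertSeries 𝒜 * (1 - PowerSeries.X) ^ d = (h : PowerSeries ℤ)

theorem IsHPolynomial.unique {k R : Type*} [Field k] [CommRing R] [Algebra k R]
    {𝒜 : ℕ → Submodule k R} {d d' : ℕ} {h h' : ℤ[X]} (H : IsHPolynomial 𝒜 d h)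
    (H' : IsHPolynomial 𝒜 d' h') : h = h' := by
  have hd : (d : WithBot ℕ∞) = d' := H.1.symm.trans H'.1
  have hd' : d = d' := by exact_mod_cast hd
  subst hd'
  exact Polynomial.coe_injective ℤ (H.2.2.symm.trans H'.2.2)

/-- The graded algebra `R` has Krull dimension `d` and multiplicity `e`: if `d > 0`, then
`e = lim (d - 1)! dim_k R_n / n^(d - 1)`; if `d = 0`, then `e` is the (finite) dimension of `R`. -/
def HasMultiplicity {k R : Type*} [Field k] [CommRing R] [Algebra k R]
    (𝒜 : ℕ → Submodule k R) (d e : ℕ) : Prop :=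
  ringKrullDim R = d ∧ (∀ n, Module.Finite k (𝒜 n)) ∧
    ((d = 0 ∧ Module.Finite k R ∧ Module.finrank k R = e) ∨
      (0 < d ∧ Tendsto
        (fun n : ℕ => ((d - 1).factorial : ℝ) * (Module.finrank k (𝒜 n) : ℝ) / (n : ℝ) ^ (d - 1))
        atTop (𝓝 (e : ℝ))))

/-! ### Generating functions of graded sets -/

/-! The monomials of degree $n$ form a basis of the degree $n$ piece, so both Hilbert series count
monoid elements by degree. Rationality is proved combinatorially (`hasRationalSeries_univ`). Suppose
a graded cancellative monoid is a finite union of translates $b_j+\langle a_1,\dots,a_m\rangle$ with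
all $a_i$ of degree one. Represent each element by its least possible $j$ and then its
lexicographically least exponent vector. For each $j$ the vectors that occur form a lower set of
$\mathbb N^m$, and a lower set is a finite disjoint union of pieces $u+\mathbb N^S$
(`IsLowerSet.isStanley`), each with series $t^{|u|}/(1-t)^{|S|}$. Uniqueness of representatives on
such a piece makes $(a_i)_{i\in S}$ independent, so $|S|\le d$ and $(1-t)^d$ is a common
denominator. For $Q$ one translate suffices; for $\overline Q$ Gordan's lemma provides finitely many
(`exists_finite_translates`).

To compare the two, write each $b_j$ as a difference of elements of $Q$; adding the subtrahends
yields $c\in Q$ with $c+\overline Q\subset Q\subset\overline Q$ (`exists_add_normalization_subset`).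
Hence $\dim k[Q]_n\le\dim k[\overline Q]_n\le\dim k[Q]_{n+\gamma}$ with $\gamma=\deg c$. For $d>0$
the coefficients of $h/(1-t)^d$ grow like $h(1)n^{d-1}/(d-1)!$ (`tendsto_coeff_div_pow`), and a
shift does not affect the leading term, so the values at $1$ agree and are the multiplicity.
Divisibility by $1-t$ is the factor theorem.

The Krull dimension is a transcendence degree by Noether normalization, and a maximal independent
family of exponents gives a transcendence basis of monomials (`ringKrullDim_addMonoidAlgebra`). -/

/-- The generating function counting the elements of `A` by their degree. -/
noncomputable def levelSeries {Y : Type*} (δ : Y → ℕ) (A : Set Y) : PowerSeries ℤ :=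
  PowerSeries.mk fun n => ((A ∩ δ ⁻¹' {n}).ncard : ℤ)

/-- The generating function of `A` is `h(t) / (1 - t)^d` with `h` a polynomial and `0 ≤ h(1)`. -/
def HasRationalSeries {Y : Type*} (d : ℕ) (δ : Y → ℕ) (A : Set Y) : Prop :=
  (∀ n, (A ∩ δ ⁻¹' {n}).Finite) ∧
    ∃ h : ℤ[X], levelSeries δ A * (1 - PowerSeries.X) ^ d = (h : PowerSeries ℤ) ∧ 0 ≤ h.eval 1

theorem levelSeries_union {Y : Type*} {δ : Y → ℕ} {A B : Set Y}
    (hA : ∀ n, (A ∩ δ ⁻¹' {n}).Finite) (hB : ∀ n, (B ∩ δ ⁻¹' {n}).Finite) (h : Disjoint A B) :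
    levelSeries δ (A ∪ B) = levelSeries δ A + levelSeries δ B := by
  ext n
  simp only [levelSeries, map_add, PowerSeries.coeff_mk]
  rw [Set.union_inter_distrib_right, Set.ncard_union_eq
    (h.mono Set.inter_subset_left Set.inter_subset_left) (hA n) (hB n)]
  push_cast; rfl

theorem HasRationalSeries.empty {Y : Type*} (d : ℕ) (δ : Y → ℕ) : HasRationalSeries d δ ∅ := by
  refine ⟨by simp, 0, ?_, by simp⟩
  have : levelSeries δ ∅ = 0 := by ext n; simp [levelSeries]
  simp [this]

theorem HasRationalSeries.union {Y : Type*} {d : ℕ} {δ : Y → ℕ} {A B : Set Y}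
    (hA : HasRationalSeries d δ A) (hB : HasRationalSeries d δ B) (h : Disjoint A B) :
    HasRationalSeries d δ (A ∪ B) := by
  obtain ⟨fA, pA, eA, nA⟩ := hA
  obtain ⟨fB, pB, eB, nB⟩ := hB
  refine ⟨fun n => ?_, pA + pB, ?_, ?_⟩
  · rw [Set.union_inter_distrib_right]; exact (fA n).union (fB n)
  · rw [levelSeries_union fA fB h, add_mul, eA, eB]; simp
  · rw [eval_add]; exact add_nonneg nA nB

theorem HasRationalSeries.biUnion {Y ι : Type*} {d : ℕ} {δ : Y → ℕ} {A : ι → Set Y}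
    (s : Finset ι) (hA : ∀ i, HasRationalSeries d δ (A i))
    (h : Pairwise fun i j => Disjoint (A i) (A j)) : HasRationalSeries d δ (⋃ i ∈ s, A i) := by
  classical
  induction s using Finset.induction_on with
  | empty => simpa using HasRationalSeries.empty d δ
  | insert i s his ih =>
    rw [Finset.set_biUnion_insert]
    refine (hA i).union ih ?_
    rw [Set.disjoint_iUnion₂_right]
    intro j hj
    exact h fun e => his (e ▸ hj)

theorem image_inter_level {X Y : Type*} {δ : X → ℕ} {ε : Y → ℕ} {c : ℕ} {A : Set X}
    {f : X → Y} (hdeg : ∀ x, ε (f x) = c + δ x) (n : ℕ) :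
    (f '' A) ∩ ε ⁻¹' {c + n} = f '' (A ∩ δ ⁻¹' {n}) := by
  ext y
  constructor
  · rintro ⟨⟨x, hx, rfl⟩, hn⟩
    refine ⟨x, ⟨hx, ?_⟩, rfl⟩
    simp only [Set.mem_preimage, Set.mem_singleton_iff, hdeg] at hn ⊢
    omega
  · rintro ⟨x, ⟨hx, hn⟩, rfl⟩
    simp only [Set.mem_preimage, Set.mem_singleton_iff] at hn
    exact ⟨⟨x, hx, rfl⟩, by simp [hdeg, hn]⟩

theorem image_inter_level_of_lt {X Y : Type*} {δ : X → ℕ} {ε : Y → ℕ} {c : ℕ} {A : Set X}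
    {f : X → Y} (hdeg : ∀ x, ε (f x) = c + δ x) {n : ℕ} (hn : n < c) :
    (f '' A) ∩ ε ⁻¹' {n} = ∅ := by
  rw [Set.eq_empty_iff_forall_notMem]
  rintro y ⟨⟨x, hx, rfl⟩, h⟩
  simp only [Set.mem_preimage, Set.mem_singleton_iff, hdeg] at h
  omega

theorem levelSeries_image {X Y : Type*} {δ : X → ℕ} {ε : Y → ℕ} {c : ℕ} {A : Set X}
    {f : X → Y} (hf : Set.InjOn f A) (hdeg : ∀ x, ε (f x) = c + δ x) :
    levelSeries ε (f '' A) = PowerSeries.X ^ c * levelSeries δ A := by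
  ext n
  rw [PowerSeries.coeff_X_pow_mul']
  simp only [levelSeries, PowerSeries.coeff_mk]
  split_ifs with hc
  · obtain ⟨m, rfl⟩ := Nat.exists_eq_add_of_le hc
    rw [image_inter_level hdeg, Nat.add_sub_cancel_left,
      (hf.mono Set.inter_subset_left).ncard_image]
  · rw [image_inter_level_of_lt hdeg (not_le.mp hc)]; simp

theorem HasRationalSeries.image {X Y : Type*} {d : ℕ} {δ : X → ℕ} {ε : Y → ℕ} {c : ℕ}
    {A : Set X} (hA : HasRationalSeries d δ A) {f : X → Y} (hf : Set.InjOn f A)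
    (hdeg : ∀ x, ε (f x) = c + δ x) : HasRationalSeries d ε (f '' A) := by
  obtain ⟨fA, pA, eA, nA⟩ := hA
  refine ⟨fun n => ?_, Polynomial.X ^ c * pA, ?_, by simpa using nA⟩
  · rcases lt_or_ge n c with hn | hn
    · rw [image_inter_level_of_lt hdeg hn]; exact Set.finite_empty
    · obtain ⟨m, rfl⟩ := Nat.exists_eq_add_of_le hn
      rw [image_inter_level hdeg]; exact (fA m).image f
  · rw [levelSeries_image hf hdeg, mul_assoc, eA]; simp

/-! ### Decompositions of lower sets of `ℕ^m` -/

/-- The translate by `u` of the coordinate submonoid of `ℕ^m` on the coordinates in `S`. -/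
def coordPiece {m : ℕ} (u : Fin m → ℕ) (S : Finset (Fin m)) : Set (Fin m → ℕ) :=
  {x | ∀ i, u i ≤ x i ∧ (i ∉ S → x i = u i)}

/-- Finite disjoint unions of translates of coordinate submonoids. -/
inductive IsStanley {m : ℕ} : Set (Fin m → ℕ) → Prop
  | empty : IsStanley ∅
  | union {A B : Set (Fin m → ℕ)} : IsStanley A → IsStanley B → Disjoint A B → IsStanley (A ∪ B)
  | piece (u : Fin m → ℕ) (S : Finset (Fin m)) : IsStanley (coordPiece u S)

/-- With `IsStanley.above`, the inductive step for lower sets: here the new coordinate is frozen at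
`k`, there it is free from `k` on. -/
theorem IsStanley.level {m : ℕ} {A : Set (Fin m → ℕ)} (hA : IsStanley A) (k : ℕ) :
    IsStanley {x : Fin (m + 1) → ℕ | x 0 = k ∧ Fin.tail x ∈ A} := by
  induction hA with
  | empty => convert IsStanley.empty using 1; ext; simp
  | @union A B _ _ hd ihA ihB =>
    convert ihA.union ihB ?_ using 1
    · ext x; simp only [Set.mem_ofPred_eq, Set.mem_union]; tauto
    · rw [Set.disjoint_left] at hd ⊢
      exact fun x hx hy => hd hx.2 hy.2
  | piece u S =>
    convert IsStanley.piece (Fin.cons k u : Fin (m + 1) → ℕ) (S.map (Fin.succEmb m)) using 1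
    ext x
    simp only [coordPiece, Set.mem_ofPred_eq, Fin.forall_fin_succ, Fin.cons_zero, Fin.cons_succ,
      Fin.tail]
    simp [Fin.succ_ne_zero]
    omega

theorem IsStanley.above {m : ℕ} {A : Set (Fin m → ℕ)} (hA : IsStanley A) (k : ℕ) :
    IsStanley {x : Fin (m + 1) → ℕ | k ≤ x 0 ∧ Fin.tail x ∈ A} := by
  induction hA with
  | empty => convert IsStanley.empty using 1; ext; simp
  | @union A B _ _ hd ihA ihB =>
    convert ihA.union ihB ?_ using 1
    · ext x; simp only [Set.mem_ofPred_eq, Set.mem_union]; tauto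
    · rw [Set.disjoint_left] at hd ⊢
      exact fun x hx hy => hd hx.2 hy.2
  | piece u S =>
    convert IsStanley.piece (Fin.cons k u : Fin (m + 1) → ℕ)
      (insert 0 (S.map (Fin.succEmb m))) using 1
    ext x
    simp only [coordPiece, Set.mem_ofPred_eq, Fin.forall_fin_succ, Fin.cons_zero, Fin.cons_succ,
      Fin.tail]
    simp [Fin.succ_ne_zero]

/-- Decreasing sequences of lower sets in a well-quasi-order stabilize. -/
theorem exists_stable_of_antitone_isLowerSet {α : Type*} [PartialOrder α] [WellQuasiOrderedLE α]
    {D : ℕ → Set α} (hD : ∀ k, IsLowerSet (D k)) (hanti : Antitone D) :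
    ∃ K, ∀ k, K ≤ k → D k = D K := by
  -- The minimal points that ever leave the sequence form an antichain, hence are finitely many.
  -- Take `K` past a stage at which each has left; any point leaving later would lie above one of
  -- them.
  have hfin : {x | Minimal (fun x => ∃ k, x ∉ D k) x}.Finite :=
    (wellQuasiOrderedLE_iff.mp ‹_›).2 _ (setOfPred_minimal_antichain _)
  choose! κ hκ using fun x (hx : x ∈ {x | Minimal (fun x => ∃ k, x ∉ D k) x}) => hx.1
  obtain ⟨K, hK⟩ := (hfin.image κ).bddAbove
  refine ⟨K, fun k hk => (hanti hk).antisymm fun x hx => ?_⟩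
  by_contra hxk
  obtain ⟨y, hyx, hy⟩ := exists_minimal_le_of_wellFoundedLT (fun x => ∃ k, x ∉ D k) x ⟨k, hxk⟩
  exact hκ y hy (hanti (hK ⟨y, hy, rfl⟩) (hD K hyx hx))

/-- The slices at fixed first coordinate are lower sets and decrease, so they are constant from some
`K` on. The finitely many slices below `K` and the product of the stable slice with $[K,\infty)$ are
handled by induction on the dimension. -/
theorem IsLowerSet.isStanley {m : ℕ} {D : Set (Fin m → ℕ)} (hD : IsLowerSet D) :
    IsStanley D := by
  induction m with
  | zero =>
    rcases D.eq_empty_or_nonempty with rfl | ⟨x, hx⟩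
    · exact .empty
    · convert IsStanley.piece x ∅ using 1
      ext y
      simp [coordPiece, Subsingleton.elim y x, hx]
  | succ m ih =>
    let E : ℕ → Set (Fin m → ℕ) := fun k => {x | (Fin.cons k x : Fin (m + 1) → ℕ) ∈ D}
    have hE : ∀ k, IsLowerSet (E k) := fun k x y hyx hx =>
      hD (Fin.cons_le_cons.mpr ⟨le_rfl, hyx⟩) hx
    have hanti : Antitone E := fun k l hkl x hx =>
      hD (Fin.cons_le_cons.mpr ⟨hkl, le_rfl⟩) hx
    obtain ⟨K, hK⟩ := exists_stable_of_antitone_isLowerSet hE hanti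
    have key : ∀ x : Fin (m + 1) → ℕ, x ∈ D ↔ Fin.tail x ∈ E (x 0) := fun x => by
      simp only [E, Set.mem_ofPred_eq, Fin.cons_self_tail]
    have hlow : ∀ L, IsStanley {x : Fin (m + 1) → ℕ | x 0 < L ∧ x ∈ D} := by
      intro L
      induction L with
      | zero => convert IsStanley.empty using 1; ext; simp
      | succ L ihL =>
        convert ihL.union ((ih (hE L)).level L) ?_ using 1
        · ext x
          simp only [Set.mem_ofPred_eq, Set.mem_union, Nat.lt_succ_iff_lt_or_eq, key]
          constructor
          · rintro ⟨h | rfl, h2⟩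
            · exact Or.inl ⟨h, h2⟩
            · exact Or.inr ⟨rfl, h2⟩
          · rintro (⟨h, h2⟩ | ⟨rfl, h2⟩)
            · exact ⟨Or.inl h, h2⟩
            · exact ⟨Or.inr rfl, h2⟩
        · rw [Set.disjoint_left]
          exact fun x hx hy => hx.1.ne hy.1
    convert (hlow K).union ((ih (hE K)).above K) ?_ using 1
    · ext x
      simp only [Set.mem_ofPred_eq, Set.mem_union]
      rcases lt_or_ge (x 0) K with h | h
      · simp [h, h.not_ge]
      · simp [h, h.not_gt, key, hK _ h]
    · rw [Set.disjoint_left]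
      exact fun x hx hy => hx.1.not_ge hy.1

/-! ### Generating functions of lower sets -/

theorem finite_sum_eq {m : ℕ} (A : Set (Fin m → ℕ)) (n : ℕ) :
    (A ∩ (fun x => ∑ i, x i) ⁻¹' {n}).Finite := by
  refine (Set.finite_Iic (fun _ : Fin m => n)).subset fun x hx i => ?_
  rw [← (show ∑ i, x i = n from hx.2)]
  exact Finset.single_le_sum (f := x) (fun _ _ => Nat.zero_le _) (Finset.mem_univ i)

/-- Adding a free direction `j` gives a set `P` that splits, according to whether $x_j=u_j$ or
$x_j>u_j$, into the old piece and $e_j+P$. Thus $(1-t)$ times the series of `P` is the old series.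
-/
theorem levelSeries_coordPiece {m : ℕ} (u : Fin m → ℕ) (S : Finset (Fin m)) :
    levelSeries (fun x : Fin m → ℕ => ∑ i, x i) (coordPiece u S) *
      (1 - PowerSeries.X) ^ S.card = PowerSeries.X ^ (∑ i, u i) := by
  induction S using Finset.induction_on with
  | empty =>
    have : coordPiece u ∅ = (fun _ : Unit => u) '' Set.univ := by
      ext x
      simp only [coordPiece, Set.mem_ofPred_eq, Set.image_univ, Set.range_const,
        Set.mem_singleton_iff]
      exact ⟨fun h => funext fun i => (h i).2 (by simp), fun h => by simp [h]⟩
    rw [this, levelSeries_image (δ := fun _ => 0) (c := ∑ i, u i)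
      (Function.injective_of_subsingleton _).injOn (by simp)]
    have h1 : levelSeries (fun _ : Unit => 0) Set.univ = 1 := by
      ext n
      simp only [levelSeries, PowerSeries.coeff_mk, PowerSeries.coeff_one, Set.univ_inter]
      split_ifs with h
      · subst h; simp
      · have : (fun _ : Unit => 0) ⁻¹' {n} = ∅ := by
          ext; simp [Ne.symm h]
        simp [this]
    simp [h1]
  | insert j S hj ih =>
    set P := coordPiece u (insert j S)
    have hu : P = coordPiece u S ∪ (fun x => Pi.single j 1 + x) '' P := by
      ext x
      constructor
      · intro hx
        by_cases h : x j = u j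
        · refine Or.inl fun i => ⟨(hx i).1, fun hi => ?_⟩
          by_cases hij : i = j
          · rw [hij, h]
          · exact (hx i).2 (by simp [hij, hi])
        · refine Or.inr ⟨x - Pi.single j 1, fun i => ?_, ?_⟩
          · have := hx i
            by_cases hij : i = j
            · subst hij
              simp; omega
            · simpa [hij] using this
          · ext i
            have := (hx i).1
            by_cases hij : i = j
            · subst hij
              simp; omega
            · simp [hij]
      · rintro (hx | ⟨y, hy, rfl⟩) i
        · exact ⟨(hx i).1, fun hi => (hx i).2 fun h => hi (Finset.mem_insert_of_mem h)⟩
        · have := hy i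
          by_cases hij : i = j
          · subst hij
            simp; omega
          · simpa [hij] using this
    have hd : Disjoint (coordPiece u S) ((fun x => Pi.single j 1 + x) '' P) := by
      rw [Set.disjoint_left]
      rintro _ hx ⟨y, hy, rfl⟩
      have h1 := (hx j).2 hj
      have h2 := (hy j).1
      simp at h1
      omega
    have hs := levelSeries_union (finite_sum_eq (coordPiece u S))
      (finite_sum_eq ((fun x => Pi.single j 1 + x) '' P)) hd
    rw [← hu, levelSeries_image (δ := fun x : Fin m → ℕ => ∑ i, x i) (c := 1)
      (add_right_injective _).injOn (fun x => by simp [Finset.sum_add_distrib])] at hs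
    rw [Finset.card_insert_of_notMem hj, pow_succ', ← ih, ← mul_assoc]
    congr 1
    linear_combination hs

theorem IsStanley.hasRationalSeries {m d : ℕ} {A : Set (Fin m → ℕ)} (hA : IsStanley A)
    (hd : ∀ u S, coordPiece u S ⊆ A → S.card ≤ d) :
    HasRationalSeries d (fun x : Fin m → ℕ => ∑ i, x i) A := by
  induction hA with
  | empty => exact .empty _ _
  | union _ _ h ihA ihB =>
    exact (ihA fun u S h => hd u S (h.trans Set.subset_union_left)).union
      (ihB fun u S h => hd u S (h.trans Set.subset_union_right)) h
  | piece u S =>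
    have hS := hd u S subset_rfl
    -- The value at $1$ is $0^{d-|S|}$: one for a piece of full dimension `d`, zero otherwise.
    refine ⟨finite_sum_eq _, Polynomial.X ^ (∑ i, u i) * (1 - Polynomial.X) ^ (d - S.card), ?_, ?_⟩
    · conv_lhs => rw [← Nat.add_sub_cancel' hS]
      rw [pow_add, ← mul_assoc, levelSeries_coordPiece]
      simp
    · simp only [eval_mul, eval_pow, eval_X, one_pow, eval_sub, eval_one, sub_self, one_mul]
      exact pow_nonneg le_rfl _

/-- A graded cancellative commutative monoid which is a finite union of translates of the
submonoid generated by finitely many elements `a i` of degree one has a rational generating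
function, with a pole at `1` of order at most the largest size of a free subfamily of `a`. -/
theorem hasRationalSeries_univ {M : Type*} [AddCommMonoid M] [IsCancelAdd M] {m r d : ℕ} (a : Fin m → M)
    (b : Fin r → M) (δ : M → ℕ)
    (hδ : ∀ j (x : Fin m → ℕ), δ (b j + ∑ i, x i • a i) = δ (b j) + ∑ i, x i)
    (hsurj : ∀ y, ∃ j, ∃ x : Fin m → ℕ, b j + ∑ i, x i • a i = y)
    (hd : ∀ S : Finset (Fin m), Set.InjOn (fun x : Fin m → ℕ => ∑ i, x i • a i)
      {x | ∀ i, i ∉ S → x i = 0} → S.card ≤ d) :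
    HasRationalSeries d δ Set.univ := by
  set f : (Fin m → ℕ) → M := fun x => ∑ i, x i • a i with hf
  have fadd : ∀ x y, f (x + y) = f x + f y := fun x y => by
    simp [hf, add_smul, Finset.sum_add_distrib]
  -- Normal forms: no smaller index represents the same element, and `x` is lexicographically least
  -- in its fibre.
  let D : Fin r → Set (Fin m → ℕ) := fun j =>
    {x | (∀ j' < j, ∀ x', b j' + f x' ≠ b j + f x) ∧ ∀ x', f x' = f x → toLex x ≤ toLex x'}
  -- A better representative of `z` becomes a better one of `z + w` after adding `w`, since the
  -- lexicographic order respects addition.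
  have hD : ∀ j, IsLowerSet (D j) := by
    rintro j z x hxz ⟨h1, h2⟩
    obtain ⟨w, rfl⟩ := exists_add_of_le hxz
    refine ⟨fun j' hj' x' he => h1 j' hj' (x' + w) ?_, fun x' he => ?_⟩
    · rw [fadd, fadd, ← add_assoc, he, add_assoc]
    · have := h2 (x' + w) (by rw [fadd, fadd, he])
      rw [toLex_add, toLex_add] at this
      exact le_of_add_le_add_right this
  have hinj : ∀ j, Set.InjOn (fun x => b j + f x) (D j) := by
    intro j x hx y hy he
    have he' : f x = f y := add_left_cancel he
    exact toLex.injective ((hx.2 y he'.symm).antisymm (hy.2 x he'))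
  have huniv : (Set.univ : Set M) = ⋃ j ∈ Finset.univ, (fun x => b j + f x) '' D j := by
    ext y
    simp only [Set.mem_univ, true_iff, Finset.mem_univ, Set.iUnion_true, Set.mem_iUnion]
    obtain ⟨j, ⟨x, hx⟩, hj⟩ :=
      WellFounded.has_min (wellFounded_lt (α := Fin r)) {j | ∃ x, b j + f x = y} (hsurj y)
    obtain ⟨z, hz, hmin⟩ :=
      WellFounded.has_min (wellFounded_lt (α := Lex (Fin m → ℕ)))
        {z | f (ofLex z) = f x} ⟨toLex x, rfl⟩
    refine ⟨j, ofLex z, ⟨fun j' hj' x' he => hj j' ⟨x', ?_⟩ hj', fun x' he => ?_⟩, ?_⟩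
    · rw [he, hz, hx]
    · exact not_lt.mp (hmin (toLex x') (he.trans hz))
    · rw [← hx]; exact congrArg (b j + ·) hz
  rw [huniv]
  refine HasRationalSeries.biUnion _ (fun j => ?_) fun i j hij => ?_
  · refine ((hD j).isStanley.hasRationalSeries fun u S hS => hd S ?_).image (hinj j)
      (fun x => hδ j x)
    intro x hx y hy he
    -- Translating by `u` moves vectors supported on `S` into `D j`, where normal forms are unique;
    -- this makes the subfamily indexed by `S` free.
    have hmem : ∀ x : Fin m → ℕ, (∀ i, i ∉ S → x i = 0) → u + x ∈ D j := fun x hx =>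
      hS fun i => ⟨by simp, fun hi => by simp [hx i hi]⟩
    refine add_left_cancel (hinj j (hmem x hx) (hmem y hy) ?_)
    change b j + f (u + x) = b j + f (u + y)
    rw [fadd, fadd, show f x = f y from he]
  · refine Set.disjoint_left.mpr ?_
    rintro _ ⟨x, hx, rfl⟩ ⟨y, hy, he⟩
    rcases lt_or_gt_of_ne hij with h | h
    · exact hy.1 i h x he.symm
    · exact hx.1 j h y he

/-! ### Growth of the coefficients -/

theorem coeff_eq_hilbertPoly_eval {f : PowerSeries ℤ} {h : ℤ[X]} {d : ℕ}
    (hf : f * (1 - PowerSeries.X) ^ d = (h : PowerSeries ℤ)) {n : ℕ}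
    (hn : (h.map (Int.castRingHom ℝ)).natDegree < n) :
    ((PowerSeries.coeff n f : ℤ) : ℝ) =
      (hilbertPoly (h.map (Int.castRingHom ℝ)) d).eval (n : ℝ) := by
  rw [← coeff_mul_invOneSubPow_eq_hilbertPoly_eval _ hn]
  have h1 : PowerSeries.map (Int.castRingHom ℝ) f * (1 - PowerSeries.X) ^ d =
      ((h.map (Int.castRingHom ℝ) : ℝ[X]) : PowerSeries ℝ) := by
    have := congrArg (PowerSeries.map (Int.castRingHom ℝ)) hf
    simpa using this
  rw [← h1, mul_assoc, ← PowerSeries.invOneSubPow_inv_eq_one_sub_pow, Units.inv_val, mul_one]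
  simp

theorem tendsto_preHilbertPoly (d k : ℕ) :
    Tendsto (fun n : ℕ => (preHilbertPoly ℝ d k).eval (n : ℝ) / (n : ℝ) ^ d) atTop
      (𝓝 ((d.factorial : ℝ)⁻¹)) := by
  have hdeg : (preHilbertPoly ℝ d k).degree = (X ^ d : ℝ[X]).degree := by
    rw [degree_X_pow, degree_eq_natDegree, natDegree_preHilbertPoly]
    intro h0
    have := leadingCoeff_preHilbertPoly ℝ d k
    rw [h0, leadingCoeff_zero] at this
    exact (inv_ne_zero (Nat.cast_ne_zero.mpr d.factorial_ne_zero)) this.symm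
  have := (div_tendsto_atTop_leadingCoeff_div_of_degree_eq _ _ hdeg).comp
    (tendsto_natCast_atTop_atTop (R := ℝ))
  simpa [leadingCoeff_preHilbertPoly, Function.comp_def] using this

/-- The Hilbert polynomial is the sum of the $p_i$ times polynomials of degree $d$ that all have
leading coefficient $1/d!$, so the leading terms add up to $p(1)/d!$. -/
theorem tendsto_hilbertPoly (p : ℝ[X]) (d : ℕ) :
    Tendsto (fun n : ℕ => (d.factorial : ℝ) * (hilbertPoly p (d + 1)).eval (n : ℝ) / (n : ℝ) ^ d)
      atTop (𝓝 (p.eval 1)) := by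
  have h1 : Tendsto (fun n : ℕ => ∑ i ∈ p.support, p.coeff i * ((d.factorial : ℝ) *
      ((preHilbertPoly ℝ d i).eval (n : ℝ) / (n : ℝ) ^ d))) atTop
      (𝓝 (∑ i ∈ p.support, p.coeff i * ((d.factorial : ℝ) * (d.factorial : ℝ)⁻¹))) :=
    tendsto_finsetSum _ fun i _ => ((tendsto_preHilbertPoly d i).const_mul _).const_mul _
  have hd : (d.factorial : ℝ) ≠ 0 := Nat.cast_ne_zero.mpr d.factorial_ne_zero
  convert h1 using 2 with n
  · rw [hilbertPoly_succ, eval_finsetSum, Finset.mul_sum, Finset.sum_div]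
    refine Finset.sum_congr rfl fun i _ => ?_
    rw [eval_smul, smul_eq_mul]
    ring
  · simp [mul_inv_cancel₀ hd, eval_eq_sum, Polynomial.sum]

/-- If `f = h / (1 - t)^d` with `d > 0` then the coefficients of `f` grow like
`h(1) n^(d - 1) / (d - 1)!`. -/
theorem tendsto_coeff_div_pow {f : PowerSeries ℤ} {h : ℤ[X]} {d : ℕ} (hd : 0 < d)
    (hf : f * (1 - PowerSeries.X) ^ d = (h : PowerSeries ℤ)) :
    Tendsto (fun n : ℕ => ((d - 1).factorial : ℝ) * ((PowerSeries.coeff n f : ℤ) : ℝ) /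
      (n : ℝ) ^ (d - 1)) atTop (𝓝 ((h.eval 1 : ℤ) : ℝ)) := by
  obtain ⟨d, rfl⟩ := Nat.exists_eq_succ_of_ne_zero hd.ne'
  have h1 := tendsto_hilbertPoly (h.map (Int.castRingHom ℝ)) d
  have h2 : (h.map (Int.castRingHom ℝ)).eval 1 = ((h.eval 1 : ℤ) : ℝ) := by
    simp
  rw [h2] at h1
  refine h1.congr' ?_
  filter_upwards [eventually_gt_atTop (h.map (Int.castRingHom ℝ)).natDegree] with n hn
  rw [coeff_eq_hilbertPoly_eval hf hn]
  simp

/-! ### Krull dimension of affine monoid algebras -/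

/-- Incomparability makes contraction of primes strictly monotone, giving one inequality; lying over
and going up lift chains, giving the other. -/
theorem ringKrullDim_eq_of_isIntegral_of_injective {R S : Type*} [CommRing R] [CommRing S]
    [Algebra R S] [Algebra.IsIntegral R S] (hinj : Function.Injective (algebraMap R S)) :
    ringKrullDim S = ringKrullDim R := by
  refine le_antisymm (Order.krullDim_le_of_strictMono (PrimeSpectrum.comap (algebraMap R S))
    fun p q hpq => Ideal.IsIntegral.comap_lt_comap hpq) ?_
  refine iSup_le fun l => ?_
  obtain ⟨P, -, hP, hPl⟩ := Ideal.exists_ideal_over_prime_of_isIntegral (S := S)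
    l.head.asIdeal ⊥ (by
      rw [← RingHom.ker_eq_comap_bot, (RingHom.injective_iff_ker_eq_bot _).mp hinj]
      exact bot_le)
  have : P.LiesOver l.head.asIdeal := ⟨hPl.symm⟩
  obtain ⟨L, hL, -⟩ := Ideal.exists_ltSeries_of_hasGoingUp l P
  rw [← hL]
  exact Order.LTSeries.length_le_krullDim L

/-- By Noether normalization `R` is integral over a polynomial ring in `s` variables. These
variables form a transcendence basis of `R`, so `s` equals the size of any other one. -/
theorem ringKrullDim_eq_trdeg_of_finiteType (k R : Type*) [Field k] [CommRing R] [IsDomain R]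
    [Algebra k R] [Algebra.FiniteType k R] {ι : Type*} [Fintype ι] {x : ι → R}
    (hx : IsTranscendenceBasis k x) : ringKrullDim R = Fintype.card ι := by
  obtain ⟨s, g, hg, hint⟩ := exists_integral_inj_algHom_of_fg k R
  have hbasis : IsTranscendenceBasis k (fun i : Fin s => g (MvPolynomial.X i)) := by
    have hind : AlgebraicIndependent k (fun i : Fin s => g (MvPolynomial.X i)) :=
      (MvPolynomial.algebraicIndependent_X (Fin s) k).map' hg
    rw [hind.isTranscendenceBasis_iff_isAlgebraic]
    have hrange : g.range = Algebra.adjoin k (Set.range fun i : Fin s => g (MvPolynomial.X i)) := by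
      rw [← Algebra.map_top, ← MvPolynomial.adjoin_range_X, AlgHom.map_adjoin, ← Set.range_comp]
      rfl
    rw [← hrange]
    refine ⟨fun r => ?_⟩
    obtain ⟨p, hp, hpr⟩ := hint r
    refine IsIntegral.isAlgebraic ⟨p.map g.rangeRestrict.toRingHom, hp.map _, ?_⟩
    rw [Polynomial.eval₂_map]
    exact hpr
  have hcard : s = Fintype.card ι := by
    have h1 := hbasis.lift_cardinalMk_eq hx
    simpa using congrArg Cardinal.toNat h1
  let := g.toRingHom.toAlgebra
  have : Algebra.IsIntegral (MvPolynomial (Fin s) k) R := ⟨hint⟩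
  rw [ringKrullDim_eq_of_isIntegral_of_injective (R := MvPolynomial (Fin s) k) hg,
    MvPolynomial.ringKrullDim_of_isNoetherianRing, ringKrullDim_eq_zero_of_field, ← hcard]
  simp


theorem AddMonoidAlgebra.isDomain_of_addSubmonoid (k : Type*) [Field k] {N : ℕ}
    (M : AddSubmonoid (Fin N → ℤ)) : IsDomain (AddMonoidAlgebra k M) := by
  have : UniqueSums M := UniqueSums.of_injective_addHom (M.subtype : M →ₙ+ (Fin N → ℤ))
    Subtype.val_injective inferInstance
  exact NoZeroDivisors.to_isDomain _

theorem AddMonoidAlgebra.single_sum_nsmul (k : Type*) [Field k] {M ι : Type*} [AddCommMonoid M]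
    [Fintype ι] (v : ι → M) (x : ι → ℕ) :
    (AddMonoidAlgebra.single (∑ i, x i • v i) 1 : AddMonoidAlgebra k M) =
      ∏ i, AddMonoidAlgebra.single (v i) 1 ^ x i := by
  have h := map_prod (AddMonoidAlgebra.of k M) (fun i => Multiplicative.ofAdd (v i) ^ x i)
    Finset.univ
  simp only [map_pow] at h
  exact h

/-- Monomials whose exponents are independent, and of which every exponent is a rational
combination, form a transcendence basis of the monoid algebra. -/
theorem AddMonoidAlgebra.isTranscendenceBasis_single (k : Type*) [Field k] {M ι : Type*}
    [AddCommMonoid M] [IsDomain (AddMonoidAlgebra k M)] [Fintype ι] (v : ι → M)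
    (hinj : Function.Injective fun x : ι → ℕ => ∑ i, x i • v i)
    (hgen : ∀ m : M, ∃ c : ℕ, c ≠ 0 ∧ ∃ p q : ι → ℕ, c • m + ∑ i, p i • v i = ∑ i, q i • v i) :
    IsTranscendenceBasis k (fun i => (AddMonoidAlgebra.single (v i) 1 : AddMonoidAlgebra k M)) := by
  set w : ι → AddMonoidAlgebra k M := fun i => AddMonoidAlgebra.single (v i) 1
  have hind : AlgebraicIndependent k w := by
    let e : (ι →₀ ℕ) →+ M :=
      { toFun := fun x => ∑ i, x i • v i
        map_zero' := by simp
        map_add' := fun x y => by simp [add_smul, Finset.sum_add_distrib] }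
    let φ : MvPolynomial ι k →ₐ[k] AddMonoidAlgebra k M := AddMonoidAlgebra.mapDomainAlgHom k k e
    have hφ : MvPolynomial.aeval w = φ := by
      refine MvPolynomial.algHom_ext fun i => ?_
      rw [MvPolynomial.aeval_X]
      have h1 : φ (MvPolynomial.X i) = AddMonoidAlgebra.single (e (Finsupp.single i 1)) 1 :=
        AddMonoidAlgebra.mapDomain_single
      have h2 : e (Finsupp.single i 1) = v i := by
        change ∑ j, (Finsupp.single i 1 : ι →₀ ℕ) j • v j = v i
        rw [Finset.sum_eq_single i (fun j _ hj => by simp [Finsupp.single_eq_of_ne hj])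
          (by simp)]
        simp
      rw [h1, h2]
    change Function.Injective (MvPolynomial.aeval w)
    rw [hφ]
    exact AddMonoidAlgebra.mapDomain_injective fun x y hxy => DFunLike.coe_injective (hinj hxy)
  rw [hind.isTranscendenceBasis_iff_isAlgebraic]
  set A := Algebra.adjoin k (Set.range w)
  have hmem : ∀ x : ι → ℕ, (AddMonoidAlgebra.single (∑ i, x i • v i) 1 : AddMonoidAlgebra k M) ∈ A :=
    fun x => by
      rw [AddMonoidAlgebra.single_sum_nsmul]
      exact prod_mem fun i _ => pow_mem (Algebra.subset_adjoin (Set.mem_range_self i)) _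
  have hmono : ∀ m : M, IsAlgebraic A (AddMonoidAlgebra.single m 1 : AddMonoidAlgebra k M) := by
    intro m
    obtain ⟨c, hc, p, q, hpq⟩ := hgen m
    let sp : A := ⟨_, hmem p⟩
    let sq : A := ⟨_, hmem q⟩
    have hsp : sp ≠ 0 := fun h => by
      have h1 := congrArg (Subtype.val) h
      simp [sp] at h1
    -- The relation $cm+\sum p_iv_i=\sum q_iv_i$ says that $t^m$ is a root of this polynomial; as `c
    -- ≠ 0`, its coefficient at `c` is the nonzero `sp`.
    refine ⟨C sp * X ^ c - C sq, fun h => hsp ?_, ?_⟩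
    · have := congrArg (fun P : A[X] => P.coeff c) h
      simpa [coeff_C, hc] using this
    · simp [sp, sq]
      rw [add_comm, hpq, sub_self]
  refine ⟨fun f => ?_⟩
  induction f using AddMonoidAlgebra.induction_on with
  | of m => exact hmono _
  | add f g hf hg => exact hf.add hg
  | smul r f hf =>
    rw [← IsScalarTower.algebraMap_smul A r f]
    exact hf.smul _


/-- A submonoid `M` of `ℤ^N` contains `rank ℤM` independent elements of which every element of `M`
is a rational combination. -/
theorem exists_independent_spanning {N : ℕ} (M : AddSubmonoid (Fin N → ℤ)) :
    ∃ (ι : Type) (_ : Fintype ι) (v : ι → M), Fintype.card ι = Module.finrank ℤ (groupSpan M) ∧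
      (Function.Injective fun x : ι → ℕ => ∑ i, x i • v i) ∧
      ∀ m : M, ∃ c : ℕ, c ≠ 0 ∧ ∃ p q : ι → ℕ, c • m + ∑ i, p i • v i = ∑ i, q i • v i := by
  let L := groupSpan M
  let v : M → L := fun m => ⟨m, AddSubgroup.subset_closure m.2⟩
  obtain ⟨s, hs, hmax⟩ := exists_maximal_linearIndepOn ℤ v
  have hind : LinearIndependent ℤ fun i : s => v i := hs
  have hind' : LinearIndependent ℤ fun i : s => ((i : M) : Fin N → ℤ) :=
    hind.map' L.subtype.toIntLinearMap (LinearMap.ker_eq_bot.mpr Subtype.val_injective)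
  have : Finite s := hind'.finite
  have := Fintype.ofFinite s
  have hspan : ∀ m : M, ∃ a : ℤ, a ≠ 0 ∧ a • v m ∈ Submodule.span ℤ (v '' s) := fun m => by
    by_cases hm : m ∈ s
    · exact ⟨1, one_ne_zero, by
        rw [one_smul]; exact Submodule.subset_span (Set.mem_image_of_mem v hm)⟩
    · exact hmax m hm
  have htors : ∀ x (hx : x ∈ L), ∃ a : ℤ, a ≠ 0 ∧
      a • (⟨x, hx⟩ : L) ∈ Submodule.span ℤ (v '' s) := by
    intro x hx
    induction hx using AddSubgroup.closure_induction with
    | mem x hx => exact hspan ⟨x, hx⟩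
    | zero => exact ⟨1, one_ne_zero, by
        rw [one_smul]; exact zero_mem (Submodule.span ℤ (v '' s))⟩
    | add x y hx hy ihx ihy =>
      obtain ⟨a, ha, hax⟩ := ihx
      obtain ⟨b, hb, hby⟩ := ihy
      refine ⟨a * b, mul_ne_zero ha hb, ?_⟩
      have h := add_mem (Submodule.smul_mem _ b hax) (Submodule.smul_mem _ a hby)
      convert h using 1
      ext i
      simp
      ring
    | neg x hx ih =>
      obtain ⟨a, ha, hax⟩ := ih
      refine ⟨a, ha, ?_⟩
      convert neg_mem hax using 1
      ext i
      simp
  have hcard : Fintype.card s = Module.finrank ℤ L := by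
    -- By maximality the quotient is torsion, so the chosen independent elements already account for
    -- the full rank.
    have h1 : Module.rank ℤ (L ⧸ Submodule.span ℤ (v '' s)) = 0 := by
      rw [rank_eq_zero_iff]
      intro y
      obtain ⟨y, rfl⟩ := Submodule.Quotient.mk_surjective _ y
      obtain ⟨a, ha, h⟩ := htors y y.2
      exact ⟨a, ha, by
        rw [← Submodule.Quotient.mk_smul]; exact (Submodule.Quotient.mk_eq_zero _).mpr h⟩
    have h2 := rank_quotient_add_rank_of_isDomain (Submodule.span ℤ (v '' s))
    rw [h1, zero_add] at h2
    rw [Module.finrank, ← h2, ← finrank_span_eq_card hind, Set.image_eq_range]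
    rfl
  let e := Fintype.equivFin s
  refine ⟨Fin (Fintype.card s), inferInstance, fun i => (e.symm i : M), by simpa using hcard,
    fun x y hxy => ?_, fun m => ?_⟩
  · have h1 : ∑ i, ((x (e i) : ℤ) - y (e i)) • ((i : M) : Fin N → ℤ) = 0 := by
      have := congrArg (fun m : M => (m : Fin N → ℤ)) hxy
      simp only [AddSubmonoid.coe_finsetSum, AddSubmonoidClass.coe_nsmul] at this
      rw [← e.sum_comp, ← e.sum_comp] at this
      simp only [sub_smul, Finset.sum_sub_distrib, natCast_zsmul]
      simpa [sub_eq_zero] using this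
    funext i
    have := Fintype.linearIndependent_iff.mp hind' _ h1 (e.symm i)
    simp at this
    omega
  · obtain ⟨a, ha, hm⟩ := hspan m
    rw [Set.image_eq_range, Submodule.mem_span_range_iff_exists_fun] at hm
    obtain ⟨z, hz⟩ := hm
    -- An integer relation becomes one over `ℕ` by moving the negative coefficients to the other
    -- side; a negative `a` is dealt with by changing all signs.
    have key : ∀ (a : ℤ) (z : s → ℤ), ∑ i, z i • v i = a • v m → 0 < a →
        ∃ c : ℕ, c ≠ 0 ∧ ∃ p q : Fin (Fintype.card s) → ℕ,
          c • m + ∑ i, p i • (e.symm i : M) = ∑ i, q i • (e.symm i : M) := by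
      intro a z hz ha
      refine ⟨a.toNat, by omega, fun i => (-(z (e.symm i))).toNat, fun i => (z (e.symm i)).toNat, ?_⟩
      have hz' : ∑ i, z i • ((i : M) : Fin N → ℤ) = a • (m : Fin N → ℤ) := by
        have := congrArg (L.subtype) hz
        simpa [v] using this
      apply Subtype.val_injective
      simp only [AddSubmonoid.coe_add, AddSubmonoid.coe_finsetSum, AddSubmonoidClass.coe_nsmul]
      rw [← natCast_zsmul, Int.toNat_of_nonneg ha.le, ← hz', ← e.symm.sum_comp,
        ← Finset.sum_add_distrib]
      refine Finset.sum_congr rfl fun i _ => ?_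
      rw [← natCast_zsmul, ← natCast_zsmul, ← add_smul]
      congr 1
      omega
    rcases lt_or_gt_of_ne ha with h | h
    · exact key (-a) (-z) (by simp [hz]) (by omega)
    · exact key a z hz h

/-- The Krull dimension of the algebra of an affine monoid is the rank of the monoid. -/
theorem ringKrullDim_addMonoidAlgebra (k : Type*) [Field k] {N : ℕ}
    (M : AddSubmonoid (Fin N → ℤ)) (hM : M.FG) :
    ringKrullDim (AddMonoidAlgebra k M) = Module.finrank ℤ (groupSpan M) := by
  have := AddMonoidAlgebra.isDomain_of_addSubmonoid k M
  have : AddMonoid.FG M := (AddMonoid.fg_iff_addSubmonoid_fg M).mpr hM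
  have : Algebra.FiniteType k (AddMonoidAlgebra k M) := AddMonoidAlgebra.finiteType_of_fg k M
  obtain ⟨ι, _, v, hcard, hinj, hgen⟩ := exists_independent_spanning M
  rw [ringKrullDim_eq_trdeg_of_finiteType k _
    (AddMonoidAlgebra.isTranscendenceBasis_single k v hinj hgen), hcard]

/-! ### Hilbert series of monoid algebras -/

/-- The graded piece of degree `n` of a monoid algebra has the monomials of degree `n` as basis. -/
noncomputable def gradeByEquivFinsupp (k : Type*) [Field k] {M : Type*} (δ : M → ℕ) (n : ℕ) :
    AddMonoidAlgebra.gradeBy k δ n ≃ₗ[k] ((Set.univ ∩ δ ⁻¹' {n} : Set M) →₀ k) :=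
  ((AddMonoidAlgebra.coeffLinearEquiv k : AddMonoidAlgebra k M ≃ₗ[k] (M →₀ k)).ofSubmodules
    (AddMonoidAlgebra.gradeBy k δ n) (Finsupp.supported k k (Set.univ ∩ δ ⁻¹' {n})) (by
      ext x
      simp only [Submodule.mem_map_equiv]
      rw [AddMonoidAlgebra.mem_gradeBy_iff, Finsupp.mem_supported, Set.univ_inter]
      rfl)).trans
    (Finsupp.supportedEquivFinsupp _)

theorem finite_gradeBy (k : Type*) [Field k] {M : Type*} {δ : M → ℕ} {n : ℕ}
    (h : (Set.univ ∩ δ ⁻¹' {n}).Finite) : Module.Finite k (AddMonoidAlgebra.gradeBy k δ n) := by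
  have := h.to_subtype
  exact Module.Finite.equiv (gradeByEquivFinsupp k δ n).symm

theorem finrank_gradeBy (k : Type*) [Field k] {M : Type*} {δ : M → ℕ} {n : ℕ}
    (h : (Set.univ ∩ δ ⁻¹' {n}).Finite) :
    Module.finrank k (AddMonoidAlgebra.gradeBy k δ n) = (Set.univ ∩ δ ⁻¹' {n}).ncard := by
  have := h.fintype
  rw [(gradeByEquivFinsupp k δ n).finrank_eq, Module.finrank_finsupp_self,
    Set.ncard_eq_toFinset_card', Set.toFinset_card]

theorem hilbertSeries_gradeBy (k : Type*) [Field k] {M : Type*} [AddCommMonoid M] {δ : M → ℕ}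
    (h : ∀ n, (Set.univ ∩ δ ⁻¹' {n}).Finite) :
    hilbertSeries (AddMonoidAlgebra.gradeBy k δ) = levelSeries δ Set.univ := by
  ext n
  simp only [hilbertSeries, levelSeries, PowerSeries.coeff_mk, finrank_gradeBy k (h n)]

/-! ### Finiteness of the normalization over the monoid -/

theorem finite_int_groupSpan {N : ℕ} (Q : AddSubmonoid (Fin N → ℤ)) :
    Module.Finite ℤ (groupSpan Q) :=
  inferInstanceAs (Module.Finite ℤ (AddSubgroup.toIntSubmodule (groupSpan Q)))

/-- A subfamily of a family in `ℤQ` that is independent over `ℕ` has at most `rank ℤQ` members. -/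
theorem card_le_finrank_groupSpan {N m : ℕ} {Q : AddSubmonoid (Fin N → ℤ)}
    {a : Fin m → Fin N → ℤ} (ha : ∀ i, a i ∈ groupSpan Q) {S : Finset (Fin m)}
    (hS : Set.InjOn (fun x : Fin m → ℕ => ∑ i, x i • a i) {x | ∀ i, i ∉ S → x i = 0}) :
    S.card ≤ Module.finrank ℤ (groupSpan Q) := by
  have := finite_int_groupSpan Q
  have hli : LinearIndependent ℤ fun i : S => (⟨a i, ha i⟩ : groupSpan Q) := by
    rw [Fintype.linearIndependent_iff]
    intro z hz
    have hz' : ∑ i : S, z i • a i = 0 := by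
      have := congrArg (groupSpan Q).subtype hz
      simpa using this
    let w : Fin m → ℤ := fun i => if h : i ∈ S then z ⟨i, h⟩ else 0
    have hw : ∑ i, w i • a i = 0 := by
      rw [← hz', ← Finset.sum_subset (Finset.subset_univ S), ← Finset.sum_coe_sort]
      · exact Finset.sum_congr rfl fun i _ => by simp [w]
      · intro i _ hi
        simp [w, hi]
    -- The positive and negative parts of the relation are exponent vectors on `S` with the same
    -- image, hence equal; equal positive and negative parts force zero.
    have hpn : (fun i => (w i).toNat) = fun i => (-(w i)).toNat := by
      refine hS (fun i hi => by simp [w, hi]) (fun i hi => by simp [w, hi]) ?_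
      rw [← sub_eq_zero, ← Finset.sum_sub_distrib, ← hw]
      refine Finset.sum_congr rfl fun i _ => ?_
      rw [← natCast_zsmul, ← natCast_zsmul, ← sub_smul]
      congr 1
      dsimp only
      omega
    intro i
    have h1 := congrFun hpn i
    have h2 : w i = z i := by simp [w]
    simp only [h2] at h1
    omega
  simpa using hli.fintype_card_le_finrank

theorem mem_closure_range_iff_exists_sum {M ι : Type*} [AddCommMonoid M] [Fintype ι] {a : ι → M}
    {y : M} : y ∈ AddSubmonoid.closure (Set.range a) ↔ ∃ x : ι → ℕ, ∑ i, x i • a i = y := by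
  rw [← Submodule.span_nat_eq_addSubmonoidClosure, Submodule.mem_toAddSubmonoid,
    Submodule.mem_span_range_iff_exists_fun]

theorem Finset.range_equivFin_symm {α : Type*} (F : Finset α) :
    Set.range (fun i => (F.equivFin.symm i : α)) = F := by
  ext x
  exact ⟨fun ⟨i, hi⟩ => hi ▸ (F.equivFin.symm i).2, fun hx => ⟨F.equivFin ⟨x, hx⟩, by simp⟩⟩

/-- The generators of a homogeneous affine monoid can be chosen of degree one. -/
theorem IsHomogeneous.exists_generators {N : ℕ} {Q : AddSubmonoid (Fin N → ℤ)}
    (hhom : IsHomogeneous Q) (hQ : Q.FG) :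
    ∃ (m : ℕ) (a : Fin m → Fin N → ℤ), AddSubmonoid.closure (Set.range a) = Q ∧
      ∀ i (hi : a i ∈ Q), hhom.degree ⟨a i, le_normalization Q hi⟩ = 1 := by
  obtain ⟨F, hF⟩ := hQ
  -- Minimality among finite generating sets is minimality among all, because every subset of `T` is
  -- finite.
  obtain ⟨T, hTF, hT⟩ := exists_minimal_le_of_wellFoundedLT
    (fun T : Finset (Fin N → ℤ) => AddSubmonoid.closure (T : Set (Fin N → ℤ)) = Q) F hF
  have hmin : IsMinimalGeneratingSet Q (T : Set (Fin N → ℤ)) := by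
    refine ⟨hT.prop, fun U hU hUT => ?_⟩
    have hfin : U.Finite := T.finite_toSet.subset hUT
    have := hT.2 (y := hfin.toFinset) (by simpa using hU) (by
      intro x hx
      exact hUT (hfin.mem_toFinset.mp hx))
    exact fun x hx => hfin.mem_toFinset.mp (this hx)
  refine ⟨T.card, fun i => T.equivFin.symm i, ?_, fun i hi => hhom.degree_eq_one hmin
    (T.equivFin.symm i).2 hi⟩
  rw [T.range_equivFin_symm, hT.prop]

theorem exists_nonneg_combination_of_mem_coneSpan {N m : ℕ} {Q : AddSubmonoid (Fin N → ℤ)}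
    {a : Fin m → Fin N → ℤ} (ha : AddSubmonoid.closure (Set.range a) = Q) {x : Fin N → ℝ}
    (hx : x ∈ coneSpan Q) :
    ∃ c : Fin m → ℝ, (∀ i, 0 ≤ c i) ∧ x = ∑ i, c i • latticeToReal N (a i) := by
  unfold coneSpan at hx
  induction hx using Submodule.span_induction with
  | mem x hx =>
    obtain ⟨y, hy, rfl⟩ := hx
    rw [← ha, SetLike.mem_coe, mem_closure_range_iff_exists_sum] at hy
    obtain ⟨c, rfl⟩ := hy
    exact ⟨fun i => c i, fun i => Nat.cast_nonneg _, by
      simp only [map_sum, map_nsmul, Nat.cast_smul_eq_nsmul]⟩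
  | zero => exact ⟨0, fun _ => le_rfl, by simp⟩
  | add x y _ _ hx hy =>
    obtain ⟨c, hc, rfl⟩ := hx
    obtain ⟨e, he, rfl⟩ := hy
    exact ⟨c + e, fun i => add_nonneg (hc i) (he i), by simp [add_smul, Finset.sum_add_distrib]⟩
  | smul r x _ hx =>
    obtain ⟨c, hc, rfl⟩ := hx
    refine ⟨fun i => r * c i, fun i => mul_nonneg r.2 (hc i), ?_⟩
    rw [Finset.smul_sum]
    exact Finset.sum_congr rfl fun i _ => (smul_assoc (r : ℝ) (c i) _).symm

theorem mem_coneSpan_of_nonneg_combination {N m : ℕ} {Q : AddSubmonoid (Fin N → ℤ)}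
    {a : Fin m → Fin N → ℤ} (ha : ∀ i, a i ∈ Q) {c : Fin m → ℝ} (hc : ∀ i, 0 ≤ c i) :
    ∑ i, c i • latticeToReal N (a i) ∈ coneSpan Q :=
  sum_mem fun i _ => Submodule.smul_mem _ (⟨c i, hc i⟩ : {c : ℝ // 0 ≤ c})
    (PointedCone.subset_hull ⟨a i, ha i, rfl⟩)

/-- Gordan's lemma: the normalization is a finite union of translates of the monoid. -/
theorem exists_finite_translates {N m : ℕ} {Q : AddSubmonoid (Fin N → ℤ)}
    {a : Fin m → Fin N → ℤ} (ha : AddSubmonoid.closure (Set.range a) = Q) :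
    ∃ (r : ℕ) (b : Fin r → normalization Q), ∀ y ∈ normalization Q,
      ∃ j, ∃ x : Fin m → ℕ, (b j : Fin N → ℤ) + ∑ i, x i • a i = y := by
  have haQ : ∀ i, a i ∈ Q := fun i => ha ▸ AddSubmonoid.subset_closure (Set.mem_range_self i)
  -- Subtracting the integer parts of the cone coefficients leaves coefficients in $[0,1]$, so the
  -- remainder is a lattice point in this box, which holds only finitely many.
  let u : Fin N → ℤ := fun l => ∑ i, |a i l|
  let B : Set (normalization Q) := {b | (b : Fin N → ℤ) ∈ Set.Icc (-u) u}
  have hB : B.Finite := (Set.finite_Icc (-u) u).preimage Subtype.val_injective.injOn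
  have := hB.fintype
  refine ⟨Fintype.card B, fun j => ((Fintype.equivFin B).symm j).1, fun y hy => ?_⟩
  obtain ⟨c, hc, hyc⟩ := exists_nonneg_combination_of_mem_coneSpan ha hy.2
  let x : Fin m → ℕ := fun i => ⌊c i⌋₊
  let b : Fin N → ℤ := y - ∑ i, x i • a i
  have hb : latticeToReal N b = ∑ i, (c i - x i) • latticeToReal N (a i) := by
    simp only [b, map_sub, map_sum, map_nsmul, hyc, sub_smul, Finset.sum_sub_distrib,
      Nat.cast_smul_eq_nsmul]
  have hfrac : ∀ i, 0 ≤ c i - x i := fun i => sub_nonneg.mpr (Nat.floor_le (hc i))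
  have hfrac1 : ∀ i, c i - x i ≤ 1 := fun i => by
    have := (Nat.lt_floor_add_one (c i)).le
    simp only [x]
    linarith
  have hbn : b ∈ normalization Q := by
    refine ⟨sub_mem hy.1 (sum_mem fun i _ => nsmul_mem (AddSubgroup.subset_closure (haQ i)) _), ?_⟩
    rw [hb]
    exact mem_coneSpan_of_nonneg_combination haQ hfrac
  have habs : ∀ l, |b l| ≤ u l := by
    intro l
    have h1 : ((b l : ℤ) : ℝ) = ∑ i, (c i - x i) * (a i l : ℝ) := by
      have := congrFun hb l
      simpa [latticeToReal] using this
    have h2 : |((b l : ℤ) : ℝ)| ≤ ∑ i, |(a i l : ℝ)| := by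
      rw [h1]
      refine (Finset.abs_sum_le_sum_abs _ _).trans (Finset.sum_le_sum fun i _ => ?_)
      rw [abs_mul, abs_of_nonneg (hfrac i)]
      exact mul_le_of_le_one_left (abs_nonneg _) (hfrac1 i)
    exact_mod_cast h2
  have hbB : (⟨b, hbn⟩ : normalization Q) ∈ B :=
    ⟨fun l => (abs_le.mp (habs l)).1, fun l => (abs_le.mp (habs l)).2⟩
  exact ⟨Fintype.equivFin B ⟨_, hbB⟩, x, by simp [b]⟩

theorem exists_add_mem_of_mem_groupSpan {N : ℕ} {Q : AddSubmonoid (Fin N → ℤ)} {y : Fin N → ℤ}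
    (hy : y ∈ groupSpan Q) : ∃ c ∈ Q, c + y ∈ Q := by
  unfold groupSpan at hy
  induction hy using AddSubgroup.closure_induction with
  | mem x hx => exact ⟨0, zero_mem _, by simpa using hx⟩
  | zero => exact ⟨0, zero_mem _, by simp⟩
  | add x y _ _ hx hy =>
    obtain ⟨c, hc, hcx⟩ := hx
    obtain ⟨e, he, hey⟩ := hy
    exact ⟨c + e, add_mem hc he, by rw [add_add_add_comm]; exact add_mem hcx hey⟩
  | neg x _ hx =>
    obtain ⟨c, hc, hcx⟩ := hx
    exact ⟨c + x, hcx, by simpa using hc⟩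

/-- An affine monoid contains a translate of its normalization. -/
theorem exists_add_normalization_subset {N : ℕ} {Q : AddSubmonoid (Fin N → ℤ)} (hQ : Q.FG) :
    ∃ c ∈ Q, ∀ y ∈ normalization Q, c + y ∈ Q := by
  obtain ⟨F, hF⟩ := hQ
  have ha := (congrArg AddSubmonoid.closure F.range_equivFin_symm).trans hF
  obtain ⟨r, b, hb⟩ := exists_finite_translates ha
  choose c hc hcb using fun j => exists_add_mem_of_mem_groupSpan (b j).2.1
  -- The sum serves every translate at once: for $y=b_j+\sum x_ia_i$, the summand $c_j$ brings $b_j$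
  -- into $Q$ and the other summands already lie there.
  refine ⟨∑ j, c j, sum_mem fun j _ => hc j, fun y hy => ?_⟩
  obtain ⟨j, x, rfl⟩ := hb y hy
  rw [← Finset.add_sum_erase _ _ (Finset.mem_univ j)]
  have h1 : ∑ i, x i • (F.equivFin.symm i : Fin N → ℤ) ∈ Q := by
    rw [← ha]; exact mem_closure_range_iff_exists_sum.mpr ⟨x, rfl⟩
  have h2 := add_mem (add_mem (hcb j) (sum_mem fun i (_ : i ∈ Finset.univ.erase j) => hc i)) h1
  convert h2 using 1
  abel

theorem groupSpan_normalization {N : ℕ} (Q : AddSubmonoid (Fin N → ℤ)) :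
    groupSpan (normalization Q) = groupSpan Q :=
  le_antisymm ((AddSubgroup.closure_le _).mpr fun _ hx => hx.1)
    (AddSubgroup.closure_mono (le_normalization Q))

theorem normalization_fg {N : ℕ} {Q : AddSubmonoid (Fin N → ℤ)} (hQ : Q.FG) :
    (normalization Q).FG := by
  obtain ⟨F, hF⟩ := hQ
  obtain ⟨r, b, hb⟩ := exists_finite_translates 
    ((congrArg AddSubmonoid.closure F.range_equivFin_symm).trans hF)
  have hFQ : ∀ x ∈ F, x ∈ Q := fun x hx => hF ▸ AddSubmonoid.subset_closure hx
  refine (AddSubmonoid.fg_iff (normalization Q)).mpr ⟨(F : Set (Fin N → ℤ)) ∪ Set.range fun j => (b j : Fin N → ℤ),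
    le_antisymm ?_ ?_, F.finite_toSet.union (Set.finite_range _)⟩
  · rw [AddSubmonoid.closure_le]
    rintro x (hx | ⟨j, rfl⟩)
    · exact le_normalization Q (hFQ x hx)
    · exact (b j).2
  · intro y hy
    obtain ⟨j, x, rfl⟩ := hb y hy
    exact add_mem (AddSubmonoid.subset_closure (Or.inr ⟨j, rfl⟩))
      (sum_mem fun i _ => nsmul_mem (AddSubmonoid.subset_closure
        (Set.mem_union_left _ (F.equivFin.symm i).2)) _)

/-! ### Comparison of the monoid and its normalization -/

/-- The degree on `Q`. -/
noncomputable def IsHomogeneous.monoidDegree {N : ℕ} {Q : AddSubmonoid (Fin N → ℤ)}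
    (hhom : IsHomogeneous Q) : Q →+ ℕ :=
  hhom.degree.comp (AddSubmonoid.inclusion (le_normalization Q))

theorem IsHomogeneous.hasRationalSeries_degree {N : ℕ} {Q : AddSubmonoid (Fin N → ℤ)}
    (hhom : IsHomogeneous Q) (hQ : Q.FG) :
    HasRationalSeries (Module.finrank ℤ (groupSpan Q)) hhom.degree Set.univ := by
  obtain ⟨m, a, ha, hdeg⟩ := hhom.exists_generators hQ
  have haQ : ∀ i, a i ∈ Q := fun i => ha ▸ AddSubmonoid.subset_closure (Set.mem_range_self i)
  obtain ⟨r, b, hb⟩ := exists_finite_translates ha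
  refine hasRationalSeries_univ (fun i => ⟨a i, le_normalization Q (haQ i)⟩) b _
    (fun j x => by simp only [map_add, map_sum, map_nsmul, hdeg _ (haQ _), smul_eq_mul, mul_one]) (fun y => ?_) fun S hS => ?_
  · obtain ⟨j, x, h⟩ := hb y y.2
    exact ⟨j, x, Subtype.ext (by simpa using h)⟩
  · refine card_le_finrank_groupSpan (fun i => AddSubgroup.subset_closure (haQ i))
      fun x hx y hy h => hS hx hy (Subtype.ext (by simpa using h))

theorem IsHomogeneous.hasRationalSeries_monoidDegree {N : ℕ} {Q : AddSubmonoid (Fin N → ℤ)}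
    (hhom : IsHomogeneous Q) (hQ : Q.FG) :
    HasRationalSeries (Module.finrank ℤ (groupSpan Q)) hhom.monoidDegree Set.univ := by
  obtain ⟨m, a, ha, hdeg⟩ := hhom.exists_generators hQ
  have haQ : ∀ i, a i ∈ Q := fun i => ha ▸ AddSubmonoid.subset_closure (Set.mem_range_self i)
  have hdeg' : ∀ i, hhom.monoidDegree ⟨a i, haQ i⟩ = 1 := fun i => hdeg i (haQ i)
  refine hasRationalSeries_univ (fun i => ⟨a i, haQ i⟩) (fun _ : Fin 1 => 0) _
    (fun j x => by simp only [map_add, map_sum, map_nsmul, hdeg', smul_eq_mul, mul_one]) (fun y => ?_) fun S hS => ?_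
  · obtain ⟨x, h⟩ := mem_closure_range_iff_exists_sum.mp (ha.ge y.2)
    exact ⟨0, x, Subtype.ext (by simpa using h)⟩
  · refine card_le_finrank_groupSpan (fun i => AddSubgroup.subset_closure (haQ i))
      fun x hx y hy h => hS hx hy (Subtype.ext (by simpa using h))

theorem IsHomogeneous.ncard_monoid_le {N : ℕ} {Q : AddSubmonoid (Fin N → ℤ)}
    (hhom : IsHomogeneous Q) {n : ℕ} (hfin : (Set.univ ∩ hhom.degree ⁻¹' {n}).Finite) :
    (Set.univ ∩ hhom.monoidDegree ⁻¹' {n}).ncard ≤ (Set.univ ∩ hhom.degree ⁻¹' {n}).ncard := by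
  refine Set.ncard_le_ncard_of_injOn (AddSubmonoid.inclusion (le_normalization Q))
    (fun x hx => ⟨trivial, hx.2⟩) (fun x _ y _ h => ?_) hfin
  exact AddSubmonoid.inclusion_injective _ h

theorem IsHomogeneous.exists_ncard_normalization_le {N : ℕ} {Q : AddSubmonoid (Fin N → ℤ)}
    (hhom : IsHomogeneous Q) (hQ : Q.FG)
    (hfin : ∀ n, (Set.univ ∩ hhom.monoidDegree ⁻¹' {n}).Finite) :
    ∃ γ : ℕ, ∀ n, (Set.univ ∩ hhom.degree ⁻¹' {n}).ncard ≤
      (Set.univ ∩ hhom.monoidDegree ⁻¹' {n + γ}).ncard := by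
  obtain ⟨c, hc, hcy⟩ := exists_add_normalization_subset hQ
  refine ⟨hhom.monoidDegree ⟨c, hc⟩, fun n => ?_⟩
  refine Set.ncard_le_ncard_of_injOn (fun y => (⟨c + y, hcy y y.2⟩ : Q)) (fun y hy => ⟨trivial, ?_⟩)
    (fun x _ y _ h => ?_) (hfin _)
  · have h1 : hhom.monoidDegree ⟨c + y, hcy y y.2⟩ =
        hhom.degree (⟨c, le_normalization Q hc⟩ + y) := rfl
    have h2 : hhom.degree y = n := hy.2
    change hhom.monoidDegree ⟨c + y, hcy y y.2⟩ = n + hhom.degree ⟨c, le_normalization Q hc⟩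
    rw [h1, map_add, h2, add_comm]
  · exact Subtype.ext (add_left_cancel (congrArg Subtype.val h))

/-- Sequences of growth `A n^e` and `B n^e`, with the second trapped between the first and a shift
of the first, have the same leading coefficient. -/
theorem eq_of_tendsto_div_pow_of_le_shift {f g : ℕ → ℝ} {e γ : ℕ} {A B : ℝ}
    (hf : Tendsto (fun n : ℕ => f n / (n : ℝ) ^ e) atTop (𝓝 A))
    (hg : Tendsto (fun n : ℕ => g n / (n : ℝ) ^ e) atTop (𝓝 B))
    (h1 : ∀ n, f n ≤ g n) (h2 : ∀ n, g n ≤ f (n + γ)) : A = B := by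
  refine le_antisymm (le_of_tendsto_of_tendsto' hf hg fun n => by gcongr; exact h1 n) ?_
  have h3 : Tendsto (fun n : ℕ => ((n + γ : ℕ) : ℝ) / (n : ℝ)) atTop (𝓝 1) := by
    have h : Tendsto (fun n : ℕ => 1 + (γ : ℝ) / (n : ℝ)) atTop (𝓝 (1 + 0)) :=
      (tendsto_const_div_atTop_nhds_zero_nat (γ : ℝ)).const_add 1
    rw [add_zero] at h
    refine h.congr' ?_
    filter_upwards [eventually_gt_atTop 0] with n hn
    have : (n : ℝ) ≠ 0 := by positivity
    push_cast
    field_simp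
  -- Here $f(n+\gamma)/n^e$ is factored as $f(n+\gamma)/(n+\gamma)^e\cdot((n+\gamma)/n)^e$.
  have h4 := ((tendsto_add_atTop_iff_nat γ).mpr hf).mul (h3.pow e)
  rw [one_pow, mul_one] at h4
  refine le_of_tendsto_of_tendsto hg h4 ?_
  filter_upwards [eventually_gt_atTop 0] with n hn
  have hn' : (0 : ℝ) < n := by positivity
  have hn2 : (0 : ℝ) < ((n + γ : ℕ) : ℝ) := by positivity
  rw [div_pow, div_mul_div_cancel₀ (pow_pos hn2 e).ne']
  gcongr
  exact h2 n

theorem ncard_fiber_of_unique {M : Type*} [Unique M] {δ : M → ℕ} (hδ : δ default = 0) (n : ℕ) :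
    (Set.univ ∩ δ ⁻¹' {n}).ncard = if n = 0 then 1 else 0 := by
  split_ifs with h
  · rw [Set.ncard_eq_one]
    exact ⟨default, Set.eq_singleton_iff_unique_mem.mpr
      ⟨⟨trivial, by simp [hδ, h]⟩, fun x _ => Unique.eq_default x⟩⟩
  · have : Set.univ ∩ δ ⁻¹' {n} = ∅ := by
      rw [Set.eq_empty_iff_forall_notMem]
      rintro x ⟨-, hx⟩
      rw [Unique.eq_default x] at hx
      exact h (hx.symm.trans hδ)
    simp [this]

/-- The algebra of the trivial monoid is the base field: its `h`-polynomial and its multiplicity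
are `1`. -/
theorem isHPolynomial_and_hasMultiplicity_of_unique (k : Type*) [Field k] {M : Type*}
    [AddCommMonoid M] [Unique M] (δ : M →+ ℕ)
    (hdim : ringKrullDim (AddMonoidAlgebra k M) = (0 : ℕ)) :
    IsHPolynomial (AddMonoidAlgebra.gradeBy k δ) 0 1 ∧
      HasMultiplicity (AddMonoidAlgebra.gradeBy k δ) 0 1 := by
  have hδ : δ default = 0 := by rw [← Unique.eq_default (0 : M), map_zero]
  have hfin : ∀ n, (Set.univ ∩ δ ⁻¹' {n}).Finite := fun n => Set.toFinite _
  let e : AddMonoidAlgebra k M ≃ₗ[k] (M →₀ k) := AddMonoidAlgebra.coeffLinearEquiv k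
  refine ⟨⟨hdim, fun n => finite_gradeBy k (hfin n), ?_⟩,
    ⟨hdim, fun n => finite_gradeBy k (hfin n), Or.inl ⟨rfl, Module.Finite.equiv e.symm, ?_⟩⟩⟩
  · rw [hilbertSeries_gradeBy k hfin]
    ext n
    simp only [levelSeries, PowerSeries.coeff_mk, ncard_fiber_of_unique hδ, pow_zero, mul_one,
      coe_one, PowerSeries.coeff_one, Nat.cast_ite, Nat.cast_one, Nat.cast_zero]
  · rw [e.finrank_eq, Module.finrank_finsupp_self]
    simp

theorem hasMultiplicity_gradeBy (k : Type*) [Field k] {M : Type*} [AddCommMonoid M] {δ : M →+ ℕ}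
    {d e : ℕ} {h : ℤ[X]} (hd : 0 < d) (H : IsHPolynomial (AddMonoidAlgebra.gradeBy k δ) d h)
    (he : (e : ℤ) = h.eval 1) : HasMultiplicity (AddMonoidAlgebra.gradeBy k δ) d e := by
  refine ⟨H.1, H.2.1, Or.inr ⟨hd, ?_⟩⟩
  have := tendsto_coeff_div_pow hd H.2.2
  rw [← he] at this
  simpa [hilbertSeries] using this

/-- For a homogeneous affine monoid `Q` of dimension `d`, the `h`-polynomials of `k[Q]` and `k[Q̄]`
exist and agree at `t = 1` (so `1 - t` divides their difference), and this common value is the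
multiplicity of both graded algebras. -/
theorem proposition3p1 (k : Type*) [Field k] (N : ℕ) (Q : AddSubmonoid (Fin N → ℤ))
    (hQ : Q.FG) (hhom : IsHomogeneous Q) (d : ℕ) (hd : Module.finrank ℤ (groupSpan Q) = d) :
    ∃ h hbar : ℤ[X],
      IsHPolynomial (monoidGrading k hhom) d h ∧
      IsHPolynomial (normalizationGrading k hhom) d hbar ∧
      h.eval 1 = hbar.eval 1 ∧
      (1 - X) ∣ hbar - h ∧
      ∃ e : ℕ, (e : ℤ) = h.eval 1 ∧
        HasMultiplicity (monoidGrading k hhom) d e ∧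
        HasMultiplicity (normalizationGrading k hhom) d e := by
  have hdimQ : ringKrullDim (AddMonoidAlgebra k Q) = d := by
    rw [ringKrullDim_addMonoidAlgebra k Q hQ, hd]
  have hdimN : ringKrullDim (AddMonoidAlgebra k (normalization Q)) = d := by
    rw [ringKrullDim_addMonoidAlgebra k _ (normalization_fg hQ), groupSpan_normalization, hd]
  -- For `d = 0` there is no growth rate to compare, but rank zero forces both monoids to be
  -- trivial.
  rcases Nat.eq_zero_or_pos d with rfl | hpos
  · have := finite_int_groupSpan Q
    have hsub : Subsingleton (groupSpan Q) := Module.finrank_zero_iff.mp hd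
    have hzero : ∀ x ∈ groupSpan Q, x = 0 := fun x hx =>
      congrArg Subtype.val (Subsingleton.elim (⟨x, hx⟩ : groupSpan Q) 0)
    let _ : Unique Q := ⟨⟨0⟩, fun x => Subtype.ext (hzero x (AddSubgroup.subset_closure x.2))⟩
    let _ : Unique (normalization Q) := ⟨⟨0⟩, fun x => Subtype.ext (hzero x x.2.1)⟩
    obtain ⟨h1, h2⟩ := isHPolynomial_and_hasMultiplicity_of_unique k hhom.monoidDegree hdimQ
    obtain ⟨h3, h4⟩ := isHPolynomial_and_hasMultiplicity_of_unique k hhom.degree hdimN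
    exact ⟨1, 1, h1, h3, rfl, by simp, 1, by simp, h2, h4⟩
  · obtain ⟨finQ, h, hh, hnonneg⟩ := hhom.hasRationalSeries_monoidDegree hQ
    obtain ⟨finN, hbar, hhbar, -⟩ := hhom.hasRationalSeries_degree hQ
    rw [hd] at hh hhbar
    have HQ : IsHPolynomial (monoidGrading k hhom) d h :=
      ⟨hdimQ, fun n => finite_gradeBy k (finQ n), by
        rw [← hh]; congr 1; exact hilbertSeries_gradeBy k finQ⟩
    have HN : IsHPolynomial (normalizationGrading k hhom) d hbar :=
      ⟨hdimN, fun n => finite_gradeBy k (finN n), by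
        rw [← hhbar]; congr 1; exact hilbertSeries_gradeBy k finN⟩
    obtain ⟨γ, hγ⟩ := hhom.exists_ncard_normalization_le hQ finQ
    have heq : h.eval 1 = hbar.eval 1 := by
      have key := eq_of_tendsto_div_pow_of_le_shift (γ := γ) (tendsto_coeff_div_pow hpos hh)
        (tendsto_coeff_div_pow hpos hhbar)
        (fun n => by
          simp only [levelSeries, PowerSeries.coeff_mk, Int.cast_natCast]
          gcongr
          exact hhom.ncard_monoid_le (finN n))
        (fun n => by
          simp only [levelSeries, PowerSeries.coeff_mk, Int.cast_natCast]
          gcongr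
          exact hγ n)
      exact_mod_cast key
    have hdvd : (1 - X : ℤ[X]) ∣ hbar - h := by
      rw [← neg_sub X (1 : ℤ[X]), neg_dvd, ← C_1, dvd_iff_isRoot, IsRoot.def, eval_sub, heq,
        sub_self]
    -- The nonnegativity carried along in `HasRationalSeries` makes the multiplicity a natural
    -- number.
    have he : ((h.eval 1).toNat : ℤ) = h.eval 1 := Int.toNat_of_nonneg hnonneg
    exact ⟨h, hbar, HQ, HN, heq, hdvd, (h.eval 1).toNat, he,
      hasMultiplicity_gradeBy k hpos HQ he, hasMultiplicity_gradeBy k hpos HN (he.trans heq)⟩
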